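/- Let $m,n,s$ be natural numbers, let $\Sigma_k\subset\mathbb{R}^n$ denote the set of vectors with at most $k$ nonzero entries, and let $A\in\mathbb{R}^{m\times n}$ satisfy the $(2s,\delta)$-restricted isometry property for some $\delta\in(0,1)$, that is, $$(1-\delta)\|x\|_2^2\le\|Ax\|_2^2\le(1+\delta)\|x\|_2^2\qquad\text{for all }x\in\Sigma_{2s}.$$ Then for each $\delta'\in(0,1)$ there exists a function $\tilde f:\mathbb{R}^m\to\mathbb{R}^n$ represented by an unbiased ReLU network with two hidden layers, i.e. there are widths $k_1,k_2$ and matrices $W_1\in\mathbb{R}^{k_1\times m}$, $W_2\in\mathbb{R}^{k_2\times k_1}$, $W_3\in\mathbb{R}^{n\times k_2}$ with $\tilde f(y)=W_3\,\phi(W_2\,\phi(W_1y))$ for all $y\in\mathbb{R}^m$, where $\phi(t)=\max\{t,0\}$ is applied componentwise, such that for all $x\in\mathbb{R}^n$ and $e\in\mathbb{R}^m$, $$\|\tilde f(Ax+e)-x\|_2\le\delta'\|x\|_2+C\,\sigma_s(x)_1+D\,\|e\|_2,$$ where $C=1+2\,\frac{1+\delta}{1-\delta}$, $D=\frac{3}{1-\delta}$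 and $\sigma_s(x)_1=\inf_{x'\in\Sigma_s}\|x-x'\|_1$. -/

import Mathlib

/-- The rectified linear unit `t ↦ max t 0`. -/
noncomputable def relu (t : ℝ) : ℝ := max t 0

/-- The parameters (weights and biases) of a feedforward neural network with `d` hidden layers,
input dimension `m` and output dimension `n`. The widths of the hidden layers are arbitrary. -/
inductive FeedforwardNet : (d m n : ℕ) → Type
  /-- no hidden layer: the final affine map `x ↦ W x + b` -/
  | output {m n : ℕ} (W : Matrix (Fin n) (Fin m) ℝ) (b : Fin n → ℝ) : FeedforwardNet 0 m n
  /-- a first hidden layer of width `k` with parameters `W`, `b`, followed by the other layers -/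
  | hidden {d m k n : ℕ} (W : Matrix (Fin k) (Fin m) ℝ) (b : Fin k → ℝ)
      (rest : FeedforwardNet d k n) : FeedforwardNet (d + 1) m n

namespace FeedforwardNet

/-- The function computed by a network with activation function `σ`: every hidden layer maps `x`
to `σ (W x + b)`, with `σ` applied componentwise, and no activation follows the last affine map. -/
def eval (σ : ℝ → ℝ) : {d m n : ℕ} → FeedforwardNet d m n → (Fin m → ℝ) → (Fin n → ℝ)
  | _, _, _, output W b, x => W.mulVec x + b
  | _, _, _, hidden W b rest, x => eval σ rest (fun i => σ ((W.mulVec x + b) i))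

/-- A network is unbiased if all its biases, including that of the output layer, vanish. -/
def IsUnbiased : {d m n : ℕ} → FeedforwardNet d m n → Prop
  | _, _, _, output _ b => b = 0
  | _, _, _, hidden _ b rest => b = 0 ∧ IsUnbiased rest

/-- The network `N` with activation function `σ` represents `f : ℝᵐ → ℝⁿ`. -/
def Represents {d m n : ℕ} (N : FeedforwardNet d m n) (σ : ℝ → ℝ)
    (f : EuclideanSpace ℝ (Fin m) → EuclideanSpace ℝ (Fin n)) : Prop :=
  ∀ x, f x = WithLp.toLp 2 (N.eval σ (WithLp.ofLp x))

end FeedforwardNet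

/-- The set `Σ_s` of `s`-sparse vectors in `ℝⁿ`: at most `s` entries are nonzero. -/
def sparseVectors (n s : ℕ) : Set (EuclideanSpace ℝ (Fin n)) :=
  {x | {i : Fin n | x i ≠ 0}.ncard ≤ s}

/-- The `ℓ₁`-norm on `ℝⁿ`. -/
def l1Norm {n : ℕ} (x : EuclideanSpace ℝ (Fin n)) : ℝ := ∑ i, |x i|

/-- The best `s`-term approximation error `σ_s(x)₁ = inf_{x' ∈ Σ_s} ‖x - x'‖₁`. -/
noncomputable def bestApproxError {n : ℕ} (s : ℕ) (x : EuclideanSpace ℝ (Fin n)) : ℝ :=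
  ⨅ x' : sparseVectors n s, l1Norm (x - (x' : EuclideanSpace ℝ (Fin n)))

/-- The `(k, δ)`-restricted isometry property (RIP) of a matrix `A`:
`(1 - δ) ‖x‖₂² ≤ ‖A x‖₂² ≤ (1 + δ) ‖x‖₂²` for all `k`-sparse `x`. -/
def SatisfiesRIP {m n : ℕ} (A : Matrix (Fin m) (Fin n) ℝ) (k : ℕ) (δ : ℝ) : Prop :=
  ∀ x ∈ sparseVectors n k,
    (1 - δ) * ‖x‖ ^ 2 ≤ ‖Matrix.toEuclideanLin A x‖ ^ 2 ∧
      ‖Matrix.toEuclideanLin A x‖ ^ 2 ≤ (1 + δ) * ‖x‖ ^ 2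

/-! By the RIP, `A` is bounded below on differences of `s`-sparse vectors, with constant `L⁻¹`, `L =
(1 - δ)^(-1/2)`. Hence a sparse `z` with `A z` nearly closest to `y` is within `2L‖y - A x‖` of
every sparse `x`, up to a small error. These constraints on `z` are convex, so local choices glue to
a continuous decoder (`exists_continuous_approximate_decoder`). ReLU ridge functions approximate it
on the compact `ℓ₁`-sphere (`closure_span_reluRidge_eq_top`). Replacing each bias `b` by `b‖y‖₁`
removes the biases and makes the network positively homogeneous, so the error becomes `ε‖y‖`
everywhere. A general `x` is compared with sparse `x'`, using `‖A(x - x')‖ ≤ √(1 + δ)‖x - x'‖₁`. -/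

theorem relu_continuous : Continuous relu := continuous_id.max continuous_const

theorem relu_mul_of_nonneg {r : ℝ} (hr : 0 ≤ r) (t : ℝ) : relu (r * t) = r * relu t := by
  simp [relu, mul_max_of_nonneg _ _ hr]

theorem relu_sub_relu_neg (t : ℝ) : relu t - relu (-t) = t := by
  rcases le_total 0 t with h | h <;> simp [relu, h]

theorem relu_add_relu_neg (t : ℝ) : relu t + relu (-t) = |t| := by
  rcases le_total 0 t with h | h <;> simp [relu, h, abs_of_nonneg, abs_of_nonpos]

/-- Taylor's formula with integral remainder expresses `exp` as a superposition of shifted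
rectified linear units. -/
theorem integral_exp_mul_relu {a b t : ℝ} (hat : a ≤ t) (htb : t ≤ b) :
    ∫ u in a..b, Real.exp u * relu (t - u) = Real.exp t - Real.exp a * (1 + t - a) := by
  have hc : Continuous fun u => Real.exp u * relu (t - u) :=
    Real.continuous_exp.mul (relu_continuous.comp (continuous_const.sub continuous_id))
  rw [← intervalIntegral.integral_add_adjacent_intervals (hc.intervalIntegrable a t)
    (hc.intervalIntegrable t b)]
  have h1 : ∫ u in a..t, Real.exp u * relu (t - u) = ∫ u in a..t, Real.exp u * (t - u) := by
    refine intervalIntegral.integral_congr fun u hu => ?_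
    rw [Set.uIcc_of_le hat] at hu
    simp [relu, hu.2]
  have h2 : ∫ u in t..b, Real.exp u * relu (t - u) = ∫ _ in t..b, (0 : ℝ) := by
    refine intervalIntegral.integral_congr fun u hu => ?_
    rw [Set.uIcc_of_le htb] at hu
    simp [relu, hu.1]
  have h3 : ∀ u ∈ Set.uIcc a t,
      HasDerivAt (fun u => Real.exp u * (1 + t - u)) (Real.exp u * (t - u)) u := by
    intro u _
    have h := (Real.hasDerivAt_exp u).mul ((hasDerivAt_id u).const_sub (1 + t))
    have he : Real.exp u * (1 + t - id u) + Real.exp u * -1 = Real.exp u * (t - u) := by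
      simp only [id]
      ring
    exact he ▸ h
  rw [h1, h2, intervalIntegral.integral_eq_sub_of_hasDerivAt h3
    (Continuous.intervalIntegrable (by fun_prop) _ _)]
  simp

/-- Averages stay in a closed convex set; rescaling by `b - a` gives the integral. -/
theorem Submodule.intervalIntegral_mem {E : Type*} [NormedAddCommGroup E] [NormedSpace ℝ E]
    [CompleteSpace E] {p : Submodule ℝ E} (hp : IsClosed (p : Set E)) {f : ℝ → E}
    (hf : Continuous f) (hfp : ∀ u, f u ∈ p) {a b : ℝ} (hab : a < b) :
    ∫ u in a..b, f u ∈ p := by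
  have h := p.convex.set_average_mem (μ := MeasureTheory.volume) (t := Set.Ioc a b) hp
    (by simpa using hab) (by simp) (Filter.Eventually.of_forall hfp)
    ((intervalIntegrable_iff_integrableOn_Ioc_of_le hab.le).1 (hf.intervalIntegrable a b))
  rw [MeasureTheory.setAverage_eq, ← intervalIntegral.integral_of_le hab.le] at h
  have h' := p.smul_mem (b - a) h
  rwa [smul_smul, MeasureTheory.measureReal_def, Real.volume_Ioc,
    ENNReal.toReal_ofReal (by linarith), mul_inv_cancel₀ (by linarith), one_smul] at h'

/-! ### Density of ReLU ridge functions. -/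

section UniversalApproximation

variable {E : Type*} [NormedAddCommGroup E] [InnerProductSpace ℝ E] {K : Set E}

/-- The ridge function `y ↦ relu (⟪w, y⟫ + b)` on `K`. -/
noncomputable def reluRidge (K : Set E) (p : E × ℝ) : C(K, ℝ) where
  toFun y := relu (inner ℝ p.1 (y : E) + p.2)
  continuous_toFun := relu_continuous.comp (by fun_prop)

/-- The exponential ridge functions `y ↦ exp ⟪w, y⟫` on `K`, as a homomorphism in `w`. -/
noncomputable def expRidge (K : Set E) : Multiplicative E →* C(K, ℝ) where
  toFun w := ⟨fun y => Real.exp (inner ℝ w.toAdd (y : E)), by fun_prop⟩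
  map_one' := by ext; simp
  map_mul' v w := by ext; simp [inner_add_left, Real.exp_add]

theorem inner_mem_span_reluRidge (w : E) :
    (⟨fun y => inner ℝ w (y : E), by fun_prop⟩ : C(K, ℝ)) ∈
      Submodule.span ℝ (Set.range (reluRidge K)) := by
  have h : (⟨fun y => inner ℝ w (y : E), by fun_prop⟩ : C(K, ℝ)) =
      reluRidge K (w, 0) - reluRidge K (-w, 0) := by
    ext y
    simp [reluRidge, relu_sub_relu_neg]
  rw [h]
  exact sub_mem (Submodule.subset_span ⟨_, rfl⟩) (Submodule.subset_span ⟨_, rfl⟩)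

theorem one_mem_span_reluRidge :
    (1 : C(K, ℝ)) ∈ Submodule.span ℝ (Set.range (reluRidge K)) := by
  have h : (1 : C(K, ℝ)) = reluRidge K (0, 1) := by
    ext y
    simp [reluRidge, relu]
  rw [h]
  exact Submodule.subset_span ⟨_, rfl⟩

/-- By `integral_exp_mul_relu` at `t = l y`, the exponential is an integral of ridge functions plus
an affine function of `l`. -/
theorem expRidge_mem_closure_span [CompactSpace K] (w : Multiplicative E) :
    expRidge K w ∈ (Submodule.span ℝ (Set.range (reluRidge K))).topologicalClosure := by
  set V := Submodule.span ℝ (Set.range (reluRidge K))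
  set l : C(K, ℝ) := ⟨fun y => inner ℝ w.toAdd (y : E), by fun_prop⟩
  set R : ℝ := ‖l‖ + 1
  have hR : 0 < R := by positivity
  have hl : ∀ y, -R ≤ l y ∧ l y ≤ R := fun y => by
    have := abs_le.1 (l.norm_coe_le_norm y)
    constructor <;> linarith [this.1, this.2]
  set F : ℝ → C(K, ℝ) := fun u => Real.exp u • reluRidge K (w.toAdd, -u)
  have hF : Continuous F := by
    refine Real.continuous_exp.smul (ContinuousMap.continuous_of_continuous_uncurry _ ?_)
    exact relu_continuous.comp (by fun_prop)
  have hFV : ∀ u, F u ∈ V.topologicalClosure := fun u =>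
    V.le_topologicalClosure (V.smul_mem _ (Submodule.subset_span ⟨_, rfl⟩))
  have hI := Submodule.intervalIntegral_mem V.isClosed_topologicalClosure hF hFV
    (show -R < R by linarith)
  have key : expRidge K w =
      (∫ u in -R..R, F u) + (Real.exp (-R) • l + (Real.exp (-R) * (1 + R)) • (1 : C(K, ℝ))) := by
    ext y
    have h1 := (ContinuousMap.evalCLM ℝ y).intervalIntegral_comp_comm
      (hF.intervalIntegrable (μ := MeasureTheory.volume) (-R) R)
    have h2 := integral_exp_mul_relu (hl y).1 (hl y).2
    have h3 : (∫ u in -R..R, F u) y = Real.exp (l y) - Real.exp (-R) * (1 + l y - -R) := by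
      rw [← h2]
      exact h1.symm
    simp only [ContinuousMap.add_apply, ContinuousMap.smul_apply, ContinuousMap.one_apply, h3,
      smul_eq_mul]
    change Real.exp (l y) = _
    ring
  rw [key]
  exact add_mem hI (V.le_topologicalClosure (add_mem (V.smul_mem _ (inner_mem_span_reluRidge _))
    (V.smul_mem _ one_mem_span_reluRidge)))

/-- Universal approximation: the span of the ridge functions `y ↦ relu (⟪w, y⟫ + b)` is dense
in `C(K, ℝ)` for compact `K`. -/
theorem closure_span_reluRidge_eq_top [CompactSpace K] :
    (Submodule.span ℝ (Set.range (reluRidge K))).topologicalClosure = ⊤ := by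
  set V := Submodule.span ℝ (Set.range (reluRidge K))
  set S := Algebra.adjoin ℝ (MonoidHom.mrange (expRidge K) : Set C(K, ℝ))
  have hS : S.SeparatesPoints := by
    intro x y hxy
    refine ⟨_, ⟨expRidge K (Multiplicative.ofAdd ((x : E) - y)),
      Algebra.subset_adjoin ⟨_, rfl⟩, rfl⟩, fun h => hxy ?_⟩
    have h' : inner ℝ ((x : E) - y) (x : E) = inner ℝ ((x : E) - y) (y : E) :=
      Real.exp_injective h
    rw [← sub_eq_zero, ← inner_sub_right, inner_self_eq_zero, sub_eq_zero] at h'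
    exact Subtype.ext h'
  have hSV : Subalgebra.toSubmodule S ≤ V.topologicalClosure := by
    -- The exponentials are closed under products, so the algebra they generate is just their linear
    -- span.
    rw [Algebra.adjoin_eq_span, Submonoid.closure_eq, Submodule.span_le]
    rintro _ ⟨w, rfl⟩
    exact expRidge_mem_closure_span w
  have htop := ContinuousMap.subalgebra_topologicalClosure_eq_top_of_separatesPoints S hS
  refine eq_top_iff.2 fun f _ => ?_
  have hf : f ∈ S.topologicalClosure := htop ▸ Algebra.mem_top
  exact Submodule.topologicalClosure_minimal _ hSV V.isClosed_topologicalClosure hf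

theorem exists_reluRidge_sum_near [CompactSpace K] (f : C(K, ℝ)) {ε : ℝ} (hε : 0 < ε) :
    ∃ c : E × ℝ →₀ ℝ, ∀ y : K,
      |(c.sum fun p a => a * relu (inner ℝ p.1 (y : E) + p.2)) - f y| < ε := by
  have hf : f ∈ closure (Submodule.span ℝ (Set.range (reluRidge K)) : Set C(K, ℝ)) := by
    rw [← Submodule.topologicalClosure_coe, closure_span_reluRidge_eq_top]
    trivial
  obtain ⟨g, hg, hfg⟩ := Metric.mem_closure_iff.1 hf ε hε
  obtain ⟨c, rfl⟩ := Finsupp.mem_span_range_iff_exists_finsupp.1 hg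
  refine ⟨c, fun y => ?_⟩
  have h := (ContinuousMap.dist_lt_iff hε).1 hfg y
  rw [dist_comm, Real.dist_eq] at h
  convert h using 3
  simp [Finsupp.sum, reluRidge]

end UniversalApproximation

open FeedforwardNet in
theorem FeedforwardNet.exists_isUnbiased_eval_eq {m n : ℕ} {ι κ : Type*} [Fintype ι] [Fintype κ]
    (σ : ℝ → ℝ) (W₁ : Matrix ι (Fin m) ℝ) (W₂ : Matrix κ ι ℝ) (W₃ : Matrix (Fin n) κ ℝ) :
    ∃ N : FeedforwardNet 2 m n, N.IsUnbiased ∧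
      ∀ y, N.eval σ y = W₃.mulVec fun k => σ (W₂.mulVec (fun i => σ (W₁.mulVec y i)) k) := by
  let e := Fintype.equivFin ι
  let e' := Fintype.equivFin κ
  refine ⟨hidden (W₁.submatrix e.symm id) 0 (hidden (W₂.submatrix e'.symm e.symm) 0
    (output (W₃.submatrix id e'.symm) 0)), ⟨rfl, rfl, rfl⟩, fun y => ?_⟩
  ext i
  simp only [eval, Matrix.mulVec, dotProduct, Matrix.submatrix_apply, add_zero, id]
  rw [← e'.sum_comp]
  refine Finset.sum_congr rfl fun k _ => ?_
  rw [← e.sum_comp]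
  simp

/-! ### Sparse vectors and the `ℓ₁`-norm. -/

theorem zero_mem_sparseVectors {n s : ℕ} : (0 : EuclideanSpace ℝ (Fin n)) ∈ sparseVectors n s := by
  simp [sparseVectors]

theorem smul_mem_sparseVectors {n s : ℕ} {x : EuclideanSpace ℝ (Fin n)}
    (hx : x ∈ sparseVectors n s) (r : ℝ) : r • x ∈ sparseVectors n s :=
  (Set.ncard_le_ncard (fun i (hi : (r • x) i ≠ 0) => show x i ≠ 0 by
    intro h; exact hi (by simp [h])) (Set.toFinite _)).trans hx

theorem sub_mem_sparseVectors {n s : ℕ} {x y : EuclideanSpace ℝ (Fin n)}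
    (hx : x ∈ sparseVectors n s) (hy : y ∈ sparseVectors n s) :
    x - y ∈ sparseVectors n (2 * s) := by
  have hsub : {i | (x - y) i ≠ 0} ⊆ {i | x i ≠ 0} ∪ {i | y i ≠ 0} := by
    intro i hi
    by_contra h
    simp only [Set.mem_union, Set.mem_ofPred_eq, not_or, not_not] at h
    exact hi (by simp [h.1, h.2])
  have hx' : {i | x i ≠ 0}.ncard ≤ s := hx
  have hy' : {i | y i ≠ 0}.ncard ≤ s := hy
  have := (Set.ncard_le_ncard hsub (Set.toFinite _)).trans (Set.ncard_union_le _ _)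
  change {i | (x - y) i ≠ 0}.ncard ≤ 2 * s
  omega

theorem single_mem_sparseVectors {n s : ℕ} (hs : 1 ≤ s) (i : Fin n) (a : ℝ) :
    EuclideanSpace.single i a ∈ sparseVectors n s := by
  refine le_trans ?_ hs
  rw [← Set.ncard_singleton i]
  refine Set.ncard_le_ncard (fun j hj => ?_) (Set.toFinite _)
  by_contra h
  exact hj (by simp [show j ≠ i from h])

theorem eq_zero_of_mem_sparseVectors_zero {n : ℕ} {x : EuclideanSpace ℝ (Fin n)}
    (hx : x ∈ sparseVectors n 0) : x = 0 := by
  have h : {i | x i ≠ 0} = ∅ := (Set.ncard_eq_zero (Set.toFinite _)).1 (Nat.le_zero.1 hx)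
  ext i
  by_contra hi
  exact (h ▸ (show i ∈ {i | x i ≠ 0} from hi) : i ∈ (∅ : Set (Fin n)))

theorem norm_map_le_mul_l1Norm {n : ℕ} {F : Type*} [NormedAddCommGroup F] [NormedSpace ℝ F]
    (T : EuclideanSpace ℝ (Fin n) →ₗ[ℝ] F) {c : ℝ}
    (hT : ∀ i, ‖T (EuclideanSpace.single i 1)‖ ≤ c) (x : EuclideanSpace ℝ (Fin n)) :
    ‖T x‖ ≤ c * l1Norm x := by
  have hx : x = ∑ i, x i • EuclideanSpace.single i (1 : ℝ) := by
    ext j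
    simp [Finset.sum_apply, Pi.single_apply]
  conv_lhs => rw [hx, map_sum]
  rw [l1Norm, Finset.mul_sum]
  refine norm_sum_le_of_le _ fun i _ => ?_
  rw [map_smul, norm_smul, Real.norm_eq_abs, mul_comm]
  exact mul_le_mul_of_nonneg_right (hT i) (abs_nonneg _)

theorem norm_le_l1Norm {n : ℕ} (x : EuclideanSpace ℝ (Fin n)) : ‖x‖ ≤ l1Norm x := by
  simpa using norm_map_le_mul_l1Norm (LinearMap.id : EuclideanSpace ℝ (Fin n) →ₗ[ℝ] _) (c := 1)
    (by simp) x

theorem l1Norm_le_mul_norm {n : ℕ} (x : EuclideanSpace ℝ (Fin n)) : l1Norm x ≤ n * ‖x‖ := by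
  calc l1Norm x ≤ ∑ _i : Fin n, ‖x‖ := Finset.sum_le_sum fun i _ => PiLp.norm_apply_le x i
    _ = n * ‖x‖ := by simp

theorem l1Norm_nonneg {n : ℕ} (x : EuclideanSpace ℝ (Fin n)) : 0 ≤ l1Norm x :=
  Finset.sum_nonneg fun _ _ => abs_nonneg _

theorem l1Norm_smul {n : ℕ} (r : ℝ) (x : EuclideanSpace ℝ (Fin n)) :
    l1Norm (r • x) = |r| * l1Norm x := by
  simp [l1Norm, abs_mul, Finset.mul_sum]

theorem continuous_l1Norm {n : ℕ} : Continuous (l1Norm (n := n)) := by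
  unfold l1Norm
  fun_prop

/-- An estimate linear in `‖x - x'‖₁` that holds for all `s`-sparse `x'` passes to the best
`s`-term approximation error. -/
theorem le_add_mul_bestApproxError {n s : ℕ} {x : EuclideanSpace ℝ (Fin n)} {a b c : ℝ}
    (hb : 0 ≤ b) (h : ∀ x' ∈ sparseVectors n s, a ≤ c + b * l1Norm (x - x')) :
    a ≤ c + b * bestApproxError s x := by
  have : Nonempty (sparseVectors n s) := ⟨⟨0, zero_mem_sparseVectors⟩⟩
  rw [bestApproxError, Real.mul_iInf_of_nonneg hb, ← sub_le_iff_le_add']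
  exact le_ciInf fun x' => sub_le_iff_le_add'.2 (h x' x'.2)

/-! ### Continuous decoding and its realization by unbiased networks. -/

/-- If `T` is bounded below on differences of elements of `S`, then `T` has a continuous
approximate decoder, which is as good as a nearest-point decoder up to an error `ε`. -/
theorem exists_continuous_approximate_decoder {E F : Type*} [NormedAddCommGroup E]
    [NormedSpace ℝ E] [NormedAddCommGroup F] {S : Set E} (hS : S.Nonempty) (T : E → F) {L : ℝ}
    (hL : 0 ≤ L) (hT : ∀ z ∈ S, ∀ x ∈ S, ‖z - x‖ ≤ L * ‖T z - T x‖) {ε : ℝ} (hε : 0 < ε) :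
    ∃ g : C(F, E), ∀ y, ∀ x ∈ S, ‖g y - x‖ ≤ 2 * L * ‖y - T x‖ + ε := by
  have hconv : ∀ y, Convex ℝ {v | ∀ x ∈ S, ‖v - x‖ ≤ 2 * L * ‖y - T x‖ + ε} := fun y => by
    have : {v | ∀ x ∈ S, ‖v - x‖ ≤ 2 * L * ‖y - T x‖ + ε} =
        ⋂ x ∈ S, Metric.closedBall x (2 * L * ‖y - T x‖ + ε) := by
      ext v
      simp [dist_eq_norm]
    rw [this]
    exact convex_iInter₂ fun x _ => convex_closedBall x _
  refine exists_continuous_forall_mem_convex_of_local_const hconv fun y => ?_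
  obtain ⟨η, hη, hηε⟩ : ∃ η : ℝ, 0 < η ∧ L * (3 * η) ≤ ε := by
    refine ⟨ε / (3 * (L + 1)), by positivity, ?_⟩
    rw [show L * (3 * (ε / (3 * (L + 1)))) = ε * (L / (L + 1)) by field_simp]
    exact mul_le_of_le_one_right hε.le (div_le_one_of_le₀ (by linarith) (by linarith))
  -- A near-minimizer at `y` still serves on the `η`-ball: near-minimality costs `η`, moving `y`
  -- costs `2η`.
  obtain ⟨_, ⟨z, hz, rfl⟩, hyz⟩ := (Metric.infDist_lt_iff (hS.image T)).1
    (lt_add_of_pos_right (Metric.infDist y (T '' S)) hη)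
  refine ⟨z, ?_⟩
  filter_upwards [Metric.ball_mem_nhds y hη] with y' hy' x hx
  have h1 : Metric.infDist y (T '' S) ≤ Metric.infDist y' (T '' S) + dist y y' :=
    Metric.infDist_le_infDist_add_dist
  have h2 : Metric.infDist y' (T '' S) ≤ dist y' (T x) :=
    Metric.infDist_le_dist_of_mem ⟨x, hx, rfl⟩
  have h3 : dist y' y < η := hy'
  have h4 : dist (T z) (T x) ≤ 2 * dist y' (T x) + 3 * η := by
    have := dist_triangle4 (T z) y y' (T x)
    rw [dist_comm (T z) y, dist_comm y y'] at this
    rw [dist_comm y y'] at h1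
    linarith
  calc ‖z - x‖ ≤ L * ‖T z - T x‖ := hT z hz x hx
    _ ≤ L * (2 * dist y' (T x) + 3 * η) := by
      rw [← dist_eq_norm]
      gcongr
    _ ≤ 2 * L * ‖y' - T x‖ + ε := by
      rw [dist_eq_norm]
      linarith

/-- The biases of a one-hidden-layer network can be traded for an additional layer if they are
multiplied by the `ℓ₁`-norm of the argument. -/
theorem exists_isUnbiased_represents_homogenized {m n : ℕ}
    (P : Finset (EuclideanSpace ℝ (Fin m) × ℝ))
    (c : Fin n → EuclideanSpace ℝ (Fin m) × ℝ → ℝ) :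
    ∃ N : FeedforwardNet 2 m n, N.IsUnbiased ∧ N.Represents relu fun y =>
      WithLp.toLp 2 fun i => ∑ p ∈ P, c i p * relu (inner ℝ p.1 y + p.2 * l1Norm y) := by
  -- The first layer outputs `relu (±y j)`. Weights `±w j + b` on these sum to `⟪w, y⟫ + b‖y‖₁`.
  obtain ⟨N, hN, hNe⟩ := FeedforwardNet.exists_isUnbiased_eval_eq relu
    (Matrix.fromRows 1 (-1) : Matrix (Fin m ⊕ Fin m) (Fin m) ℝ)
    (Matrix.of fun p : P => Sum.elim (fun i => p.1.1 i + p.1.2) (fun i => -p.1.1 i + p.1.2))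
    (Matrix.of fun i (p : P) => c i p)
  refine ⟨N, hN, fun y => ?_⟩
  rw [hNe]
  refine congrArg (WithLp.toLp 2) (funext fun i => ?_)
  rw [← Finset.sum_coe_sort]
  simp only [Matrix.mulVec, dotProduct, Matrix.of_apply]
  refine Finset.sum_congr rfl fun p _ => ?_
  congr 2
  have h1 : ∀ j, Matrix.mulVec (1 : Matrix (Fin m) (Fin m) ℝ) y.ofLp j = y j := by simp
  have h2 : ∀ j, Matrix.mulVec (-1 : Matrix (Fin m) (Fin m) ℝ) y.ofLp j = -y j := by
    simp [Matrix.neg_mulVec]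
  simp only [Matrix.mulVec, dotProduct] at h1 h2
  simp only [Fintype.sum_sum_type, Sum.elim_inl, Sum.elim_inr, Matrix.fromRows_apply_inl,
    Matrix.fromRows_apply_inr, h1, h2, PiLp.inner_apply, l1Norm, Finset.mul_sum,
    ← Finset.sum_add_distrib]
  refine Finset.sum_congr rfl fun j _ => ?_
  rw [← relu_add_relu_neg, show inner ℝ (p.1.1.ofLp j) (y.ofLp j) = p.1.1.ofLp j * y.ofLp j by
    simp [mul_comm]]
  linear_combination -p.1.1.ofLp j * relu_sub_relu_neg (y.ofLp j)

theorem isCompact_setOf_l1Norm_eq_one (m : ℕ) :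
    IsCompact {y : EuclideanSpace ℝ (Fin m) | l1Norm y = 1} := by
  refine (isCompact_closedBall 0 1).of_isClosed_subset
    (isClosed_eq continuous_l1Norm continuous_const) fun y hy => ?_
  rw [mem_closedBall_zero_iff]
  exact (norm_le_l1Norm y).trans_eq hy

/-- Unbiased ReLU networks with two hidden layers compute positively homogeneous functions that
approximate any continuous function on the `ℓ₁`-unit sphere. -/
theorem exists_isUnbiased_near_on_sphere {m n : ℕ}
    (g : C(EuclideanSpace ℝ (Fin m), EuclideanSpace ℝ (Fin n))) {ε : ℝ} (hε : 0 < ε) :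
    ∃ f : EuclideanSpace ℝ (Fin m) → EuclideanSpace ℝ (Fin n),
      (∃ N : FeedforwardNet 2 m n, N.IsUnbiased ∧ N.Represents relu f) ∧
      (∀ r : ℝ, 0 ≤ r → ∀ y, f (r • y) = r • f y) ∧
      ∀ y, l1Norm y = 1 → ‖f y - g y‖ ≤ ε := by
  set K := {y : EuclideanSpace ℝ (Fin m) | l1Norm y = 1}
  have : CompactSpace K := isCompact_iff_compactSpace.1 (isCompact_setOf_l1Norm_eq_one m)
  have hη : 0 < ε / (n + 1) := by positivity
  choose c hc using fun i : Fin n => exists_reluRidge_sum_near (K := K)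
    ⟨fun y => g y i, by fun_prop⟩ hη
  classical
  -- All output coordinates share one hidden layer, indexed by the union of their supports.
  refine ⟨_, exists_isUnbiased_represents_homogenized
    (Finset.univ.biUnion fun i => (c i).support) fun i => c i, fun r hr y => ?_, fun y hy => ?_⟩
  · ext i
    simp only [PiLp.smul_apply, smul_eq_mul, Finset.mul_sum]
    refine Finset.sum_congr rfl fun p _ => ?_
    rw [l1Norm_smul, abs_of_nonneg hr, inner_smul_right, mul_left_comm p.2, ← mul_add,
      relu_mul_of_nonneg hr, mul_left_comm]
  · refine (norm_le_l1Norm _).trans ?_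
    calc _ ≤ ∑ _i : Fin n, ε / (n + 1) := Finset.sum_le_sum fun i _ => ?_
      _ ≤ ε := by
        rw [Finset.sum_const, Finset.card_univ, Fintype.card_fin, nsmul_eq_mul,
          mul_div_left_comm]
        exact mul_le_of_le_one_right hε.le (div_le_one_of_le₀ (by linarith) (by positivity))
    have h := hc i ⟨y, hy⟩
    rw [Finsupp.sum_of_support_subset (c i)
      (Finset.subset_biUnion_of_mem (fun i => (c i).support) (Finset.mem_univ i)) _
      (by simp)] at h
    simpa [hy] using h.le

/-- A linear map that is bounded below on differences of elements of a cone has an unbiased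
two-hidden-layer ReLU network as approximate decoder. -/
theorem exists_isUnbiased_approximate_decoder {m n : ℕ} {S : Set (EuclideanSpace ℝ (Fin n))}
    (h0 : 0 ∈ S) (hS : ∀ r : ℝ, ∀ x ∈ S, r • x ∈ S)
    (T : EuclideanSpace ℝ (Fin n) →ₗ[ℝ] EuclideanSpace ℝ (Fin m)) {L : ℝ} (hL : 0 ≤ L)
    (hT : ∀ z ∈ S, ∀ x ∈ S, ‖z - x‖ ≤ L * ‖T z - T x‖) {ε : ℝ} (hε : 0 < ε) :
    ∃ f : EuclideanSpace ℝ (Fin m) → EuclideanSpace ℝ (Fin n),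
      (∃ N : FeedforwardNet 2 m n, N.IsUnbiased ∧ N.Represents relu f) ∧
      ∀ y, ∀ x ∈ S, ‖f y - x‖ ≤ 2 * L * ‖y - T x‖ + ε * ‖y‖ := by
  -- The factor 2 covers decoder and network errors; `m + 1` covers `‖y‖₁ ≤ m‖y‖`.
  have hη : 0 < ε / (2 * (m + 1)) := by positivity
  obtain ⟨g, hg⟩ := exists_continuous_approximate_decoder ⟨0, h0⟩ T hL hT hη
  obtain ⟨f, hN, hf, hfg⟩ := exists_isUnbiased_near_on_sphere g hη
  refine ⟨f, hN, fun y x hx => ?_⟩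
  rcases eq_or_ne y 0 with rfl | hy
  · have h1 := hT 0 h0 x hx
    have h2 := hf 0 le_rfl 0
    have h3 := mul_nonneg hL (norm_nonneg (T x))
    simp only [zero_smul] at h2
    simp only [zero_sub, norm_neg, map_zero, h2, norm_zero, mul_zero, add_zero] at h1 ⊢
    linarith
  · set r := l1Norm y
    have hr : 0 < r := (norm_pos_iff.2 hy).trans_le (norm_le_l1Norm y)
    have hy1 : l1Norm (r⁻¹ • y) = 1 := by
      rw [l1Norm_smul, abs_of_pos (inv_pos.2 hr), inv_mul_cancel₀ hr.ne']
    have h1 := hfg _ hy1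
    have h2 := hg (r⁻¹ • y) (r⁻¹ • x) (hS _ x hx)
    have h3 : ‖f (r⁻¹ • y) - r⁻¹ • x‖ ≤
        2 * L * ‖r⁻¹ • y - T (r⁻¹ • x)‖ + 2 * (ε / (2 * (m + 1))) := by
      have := norm_sub_le_norm_sub_add_norm_sub (f (r⁻¹ • y)) (g (r⁻¹ • y)) (r⁻¹ • x)
      linarith
    rw [hf _ (inv_nonneg.2 hr.le), map_smul, ← smul_sub, ← smul_sub, norm_smul, norm_smul,
      Real.norm_of_nonneg (inv_nonneg.2 hr.le)] at h3
    have h4 := mul_le_mul_of_nonneg_left h3 hr.le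
    rw [mul_inv_cancel_left₀ hr.ne', mul_add, mul_left_comm r, mul_inv_cancel_left₀ hr.ne'] at h4
    have h5 : r * (2 * (ε / (2 * (m + 1)))) ≤ ε * ‖y‖ := by
      have hm : r ≤ (m + 1) * ‖y‖ :=
        (l1Norm_le_mul_norm y).trans (by nlinarith [norm_nonneg y])
      rw [show r * (2 * (ε / (2 * (m + 1)))) = ε * r / (m + 1) by field_simp,
        div_le_iff₀ (by positivity)]
      nlinarith
    linarith

/-! ### Consequences of the RIP and the final estimate. -/

namespace SatisfiesRIP

variable {m n : ℕ} {A : Matrix (Fin m) (Fin n) ℝ} {δ : ℝ}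

/-- Only the images of the standard basis vectors, which are 1-sparse, need to be bounded. -/
theorem norm_toEuclideanLin_le {k : ℕ} (hA : SatisfiesRIP A k δ) (hk : 1 ≤ k)
    (x : EuclideanSpace ℝ (Fin n)) : ‖Matrix.toEuclideanLin A x‖ ≤ √(1 + δ) * l1Norm x := by
  refine norm_map_le_mul_l1Norm _ (fun i => Real.le_sqrt_of_sq_le ?_) x
  simpa using (hA _ (single_mem_sparseVectors hk i 1)).2

theorem norm_le_mul_norm_toEuclideanLin {k : ℕ} (hA : SatisfiesRIP A k δ) (hδ : δ < 1)
    {x : EuclideanSpace ℝ (Fin n)} (hx : x ∈ sparseVectors n k) :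
    ‖x‖ ≤ (√(1 - δ))⁻¹ * ‖Matrix.toEuclideanLin A x‖ := by
  have hpos : 0 < √(1 - δ) := Real.sqrt_pos.2 (by linarith)
  rw [le_inv_mul_iff₀ hpos]
  refine (sq_le_sq₀ (by positivity) (norm_nonneg _)).1 ?_
  rw [mul_pow, Real.sq_sqrt (by linarith)]
  exact (hA x hx).1

end SatisfiesRIP

theorem mainTheorem2 {m n : ℕ} (s : ℕ) (A : Matrix (Fin m) (Fin n) ℝ) (δ : ℝ)
    (hδ : δ ∈ Set.Ioo (0 : ℝ) 1) (hA : SatisfiesRIP A (2 * s) δ)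
    (δ' : ℝ) (hδ' : δ' ∈ Set.Ioo (0 : ℝ) 1) :
    ∃ f : EuclideanSpace ℝ (Fin m) → EuclideanSpace ℝ (Fin n),
      (∃ N : FeedforwardNet 2 m n, N.IsUnbiased ∧ N.Represents relu f) ∧
      ∀ (x : EuclideanSpace ℝ (Fin n)) (e : EuclideanSpace ℝ (Fin m)),
        ‖f (Matrix.toEuclideanLin A x + e) - x‖ ≤
          δ' * ‖x‖ + (1 + 2 * ((1 + δ) / (1 - δ))) * bestApproxError s x
            + 3 / (1 - δ) * ‖e‖ := by
  obtain ⟨hδ0, hδ1⟩ := hδ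
  obtain ⟨hδ'0, hδ'1⟩ := hδ'
  set T := Matrix.toEuclideanLin A
  have h1δ : 0 < 1 - δ := by linarith
  have hq : 1 ≤ (1 + δ) / (1 - δ) := by rw [le_div_iff₀ h1δ]; linarith
  have hC : 0 ≤ 1 + 2 * ((1 + δ) / (1 - δ)) := by linarith
  set L := (√(1 - δ))⁻¹
  have hL : 0 ≤ L := by positivity
  have hL1 : 1 ≤ L := (one_le_inv₀ (Real.sqrt_pos.2 h1δ)).2 (Real.sqrt_le_one.2 (by linarith))
  have hLsq : L ^ 2 = 1 / (1 - δ) := by rw [inv_pow, Real.sq_sqrt h1δ.le, one_div]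
  have hLq : L * √(1 + δ) ≤ (1 + δ) / (1 - δ) := by
    refine (sq_le_sq₀ (by positivity) (by linarith)).1 ?_
    rw [mul_pow, hLsq, Real.sq_sqrt (by linarith), one_div_mul_eq_div]
    nlinarith
  obtain ⟨M, hM0, hM⟩ : ∃ M : ℝ, 0 ≤ M ∧ ∀ x, ‖T x‖ ≤ M * ‖x‖ :=
    ⟨_, norm_nonneg _, T.toContinuousLinearMap.le_opNorm⟩
  obtain ⟨ε, hε, hε1, hεM⟩ : ∃ ε : ℝ, 0 < ε ∧ ε ≤ 1 ∧ ε * M ≤ δ' := by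
    refine ⟨δ' / (M + 1), by positivity, ?_, ?_⟩
    · rw [div_le_one (by positivity)]; linarith
    · rw [div_mul_eq_mul_div, div_le_iff₀ (by positivity)]; nlinarith
  obtain ⟨f, hN, hf⟩ := exists_isUnbiased_approximate_decoder (S := sparseVectors n s)
    zero_mem_sparseVectors (fun r x hx => smul_mem_sparseVectors hx r) T hL
    (fun z hz x hx => by
      rw [← map_sub]
      exact hA.norm_le_mul_norm_toEuclideanLin hδ1 (sub_mem_sparseVectors hz hx)) hε
  -- Since `ε ≤ 1 ≤ L`, the left side is at most `3 * L ^ 2`.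
  have hD : 2 * L + ε ≤ 3 / (1 - δ) := by
    rw [← mul_one_div, ← hLsq]
    nlinarith
  rcases Nat.eq_zero_or_pos s with rfl | hs
  -- For `s = 0` the RIP says nothing about `A`, but the zero decoder works: the only competitor is
  -- `x' = 0`, and `‖x‖ ≤ ‖x‖₁`.
  · obtain ⟨N, hN, hNe⟩ := FeedforwardNet.exists_isUnbiased_eval_eq relu
      (0 : Matrix (Fin 0) (Fin m) ℝ) (0 : Matrix (Fin 0) (Fin 0) ℝ) (0 : Matrix (Fin n) (Fin 0) ℝ)
    refine ⟨0, ⟨N, hN, fun y => by rw [hNe]; simp⟩, fun x e => ?_⟩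
    rw [add_right_comm]
    refine le_add_mul_bestApproxError hC fun x' hx' => ?_
    rw [eq_zero_of_mem_sparseVectors_zero hx']
    simp only [Pi.zero_apply, zero_sub, norm_neg, sub_zero]
    have h1 := norm_le_l1Norm x
    have h2 : 0 ≤ 3 / (1 - δ) * ‖e‖ := by positivity
    have h3 : 0 ≤ δ' * ‖x‖ := by positivity
    nlinarith [l1Norm_nonneg x]
  · refine ⟨f, hN, fun x e => ?_⟩
    rw [add_right_comm]
    refine le_add_mul_bestApproxError hC fun x' hx' => ?_
    have hAx := hA.norm_toEuclideanLin_le (by omega) (x - x')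
    have h1 : ‖T x + e - T x'‖ ≤ √(1 + δ) * l1Norm (x - x') + ‖e‖ := by
      rw [add_sub_right_comm, ← map_sub]
      exact (norm_add_le _ _).trans (by gcongr)
    have h2 : ‖T x + e‖ ≤ M * ‖x‖ + ‖e‖ := (norm_add_le _ _).trans (by gcongr; exact hM x)
    have h3 : ‖x' - x‖ ≤ l1Norm (x - x') := norm_sub_rev x' x ▸ norm_le_l1Norm _
    calc ‖f (T x + e) - x‖
        ≤ ‖f (T x + e) - x'‖ + ‖x' - x‖ := norm_sub_le_norm_sub_add_norm_sub _ _ _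
      _ ≤ 2 * L * (√(1 + δ) * l1Norm (x - x') + ‖e‖) + ε * (M * ‖x‖ + ‖e‖)
          + l1Norm (x - x') := by
        refine add_le_add ((hf _ x' hx').trans ?_) h3
        gcongr
      _ = ε * M * ‖x‖ + (2 * L + ε) * ‖e‖ + (1 + 2 * (L * √(1 + δ))) * l1Norm (x - x') := by
        ring
      _ ≤ _ := by
        have := l1Norm_nonneg (x - x')
        gcongr
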